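/- Let $E$ be a real Banach space with dual $E^*$ and bidual $E^{**}$, and write $\langle\cdot,\cdot\rangle$ for the pairings $E\times E^*\to\mathbb R$ and $E^*\times E^{**}\to\mathbb R$. For a multifunction $S\colon E\rightrightarrows E^*$ with graph $G(S)$, let $$\varphi_S(x,x^*)=\sup_{(s,s^*)\in G(S)}\big[\langle s,x^*\rangle+\langle x,s^*\rangle-\langle s,s^*\rangle\big]\qquad((x,x^*)\in E\times E^*)$$ be its Fitzpatrick function, and let $$\varphi_S^*(y^*,y^{**})=\sup_{(x,x^*)\in E\times E^*}\big[\langle x,y^*\rangle+\langle x^*,y^{**}\rangle-\varphi_S(x,x^*)\big]\qquad((y^*,y^{**})\in E^*\times E^{**})$$ be the Fenchel conjugate of $\varphi_S$. The Fitzpatrick extension of $S$ is the multifunction $S^{\mathbb F}\colon E^*\rightrightarrows E^{**}$ given by $$(y^*,y^{**})\in G(S^{\mathbb F})\iff\varphi_S^*(y^*,y^{**})=\langle y^*,y^{**}\rangle.$$ For a proper convex lower semicontinuous $f\colon E\to{]-\infty,\infty]}$ with Fenchel conjugate $f^*(x^*)=\sup_{x\in E}[\langle x,x^*\rangle-f(x)]$,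 the subdifferential $\partial f\colon E\rightrightarrows E^*$ is given by $x^*\in\partial f(x)\iff f(x)+f^*(x^*)=\langle x,x^*\rangle$. **Theorem.** Let $\widetilde K$ be a nonempty convex subset of $E^*$ that is compact in the weak* topology $w(E^*,E)$, and define $\tau_{\widetilde K}\colon E\to\mathbb R$ by $\tau_{\widetilde K}(x)=\max_{k\in\widetilde K}\langle x,k\rangle$. Then, for all $(y^*,y^{**})\in E^*\times E^{**}$, $$(y^*,y^{**})\in G\big((\partial\tau_{\widetilde K})^{\mathbb F}\big)\iff y^*\in\widetilde K\ \text{ and }\ \langle y^*,y^{**}\rangle=\sup_{k\in\widetilde K}\langle k,y^{**}\rangle.$$ -/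

import Mathlib

noncomputable section

namespace FitzExt

/-- The Fenchel conjugate `f*(x*) = sup_x [⟨x, x*⟩ - f x]` of an extended-real-valued function
on a real normed space. -/
def fenchelConj {X : Type*} [NormedAddCommGroup X] [NormedSpace ℝ X]
    (f : X → EReal) (x' : StrongDual ℝ X) : EReal :=
  ⨆ x : X, (((x' x : ℝ) : EReal) - f x)

/-- The subdifferential of `f`, as a multifunction from `X` to its dual:
`x* ∈ ∂f(x)` if and only if `f(x) + f*(x*) = ⟨x, x*⟩`. -/
def subdiff {X : Type*} [NormedAddCommGroup X] [NormedSpace ℝ X]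
    (f : X → EReal) (x : X) : Set (StrongDual ℝ X) :=
  {x' | f x + fenchelConj f x' = ((x' x : ℝ) : EReal)}

/-- The graph of a multifunction. -/
def graph {X Y : Type*} (S : X → Set Y) : Set (X × Y) :=
  {p | p.2 ∈ S p.1}

/-- The Fitzpatrick function
`φ_S(x, x*) = sup {⟨s, x*⟩ + ⟨x, s*⟩ - ⟨s, s*⟩ : (s, s*) ∈ G(S)}` of a multifunction. -/
def fitzFun {E : Type*} [NormedAddCommGroup E] [NormedSpace ℝ E]
    (S : E → Set (StrongDual ℝ E)) (p : E × StrongDual ℝ E) : EReal :=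
  ⨆ q ∈ graph S, ((p.2 q.1 + q.2 p.1 - q.2 q.1 : ℝ) : EReal)

/-- The Fitzpatrick extension `S^F` of `S`, a multifunction from `E*` to `E**`:
`y** ∈ S^F(y*)` if and only if `φ_S*(y*, y**) = ⟨y*, y**⟩`. The pair `(y*, y**)` stands for the
functional `(x, x*) ↦ ⟨x, y*⟩ + ⟨x*, y**⟩` on `E × E*`, which is `y*.coprod y**`. -/
def fitzExt {E : Type*} [NormedAddCommGroup E] [NormedSpace ℝ E]
    (S : E → Set (StrongDual ℝ E)) (y' : StrongDual ℝ E) :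
    Set (StrongDual ℝ (StrongDual ℝ E)) :=
  {y'' | fenchelConj (fitzFun S) (y'.coprod y'') = ((y'' y' : ℝ) : EReal)}

/-- The support functional `τ_K(x) = sup {⟨x, k⟩ : k ∈ K}` of a set `K ⊆ E*`; the supremum is
attained when `K` is nonempty and weak*-compact, see `tau_isGreatest`. -/
def tau {E : Type*} [NormedAddCommGroup E] [NormedSpace ℝ E]
    (K : Set (StrongDual ℝ E)) (x : E) : EReal :=
  ⨆ k ∈ K, ((k x : ℝ) : EReal)

theorem tau_isGreatest {E : Type*} [NormedAddCommGroup E] [NormedSpace ℝ E]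
    (K : Set (StrongDual ℝ E)) (hne : K.Nonempty)
    (hK : IsCompact (StrongDual.toWeakDual '' K)) (x : E) :
    IsGreatest ((fun k : StrongDual ℝ E => ((k x : ℝ) : EReal)) '' K) (tau K x) := by
  obtain ⟨w, ⟨k, hk, rfl⟩, hmax⟩ := hK.exists_isMaxOn (hne.image _)
    (WeakDual.eval_continuous x).continuousOn
  have hle : ∀ k' ∈ K, k' x ≤ k x := fun k' hk' => hmax ⟨k', hk', rfl⟩
  have h : tau K x = ((k x : ℝ) : EReal) := by
    apply le_antisymm
    · exact iSup₂_le fun k' hk' => EReal.coe_le_coe_iff.2 (hle k' hk')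
    · exact le_iSup₂ (f := fun (k : StrongDual ℝ E) (_ : k ∈ K) => ((k x : ℝ) : EReal)) k hk
  rw [h]
  refine ⟨⟨k, hk, rfl⟩, ?_⟩
  rintro _ ⟨k', hk', rfl⟩
  exact EReal.coe_le_coe_iff.2 (hle k' hk')

end FitzExt

end

/-!
The subdifferential of `τ_K` at `x` is the face of `K` on which evaluation at `x` is maximal. It is
unchanged when `x` is multiplied by a positive scalar, and it is nonempty because the maximum is
attained; so if some `s` separates `x*` from `K`, the points of the ray through `s` drive the terms
of `φ_{∂τ_K}(x, x*)` to infinity, while for `x* ∈ K` the pairs `(0, k)` already give `τ_K(x)`.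
Together with the Fenchel–Young upper bound this splits the Fitzpatrick function,
`φ_{∂τ_K}(x, x*) = τ_K(x) + τ_K*(x*)`, hence also its conjugate, as `τ_K*(y*) + τ_K**(y**)`.
Since `τ_K*` is the indicator function of `K` (`0` on `K` and `⊤` elsewhere), its conjugate `τ_K**`
is the support function of `K` on `E**`.
-/

namespace FitzExt

theorem eq_top_of_forall_mul_add_le {a b : ℝ} {c : EReal} (ha : 0 < a)
    (h : ∀ t : ℝ, 0 < t → ((t * a + b : ℝ) : EReal) ≤ c) : c = ⊤ := by
  refine (EReal.eq_top_iff_forall_lt c).2 fun z => ?_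
  refine lt_of_lt_of_le (EReal.coe_lt_coe_iff.2 ?_) (h ((|z - b| + 1) / a) (by positivity))
  rw [div_mul_cancel₀ _ ha.ne']
  linarith [le_abs_self (z - b)]

theorem exists_real_of_add_eq_coe {x y : EReal} {c : ℝ} (h : x + y = c) :
    ∃ a b : ℝ, x = a ∧ y = b ∧ a + b = c := by
  induction x <;> induction y <;>
    first
    | exact ⟨_, _, rfl, rfl, by exact_mod_cast h⟩
    | simp at h

section Conjugate

variable {X Y : Type*} [NormedAddCommGroup X] [NormedSpace ℝ X]
  [NormedAddCommGroup Y] [NormedSpace ℝ Y]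

theorem apply_sub_le_fenchelConj (f : X → EReal) (x' : StrongDual ℝ X) (x : X) :
    ((x' x : ℝ) : EReal) - f x ≤ fenchelConj f x' :=
  le_iSup (fun x => ((x' x : ℝ) : EReal) - f x) x

theorem fenchelConj_add_coprod {f : X → EReal} {g : Y → EReal} (hf : ∀ x, f x ≠ ⊥)
    (hg : ∀ y, g y ≠ ⊥) (x' : StrongDual ℝ X) (y' : StrongDual ℝ Y) :
    fenchelConj (fun p : X × Y => f p.1 + g p.2) (x'.coprod y') =
      fenchelConj f x' + fenchelConj g y' := by
  have hterm : ∀ x y, (((x'.coprod y') (x, y) : ℝ) : EReal) - (f x + g y) =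
      ((x' x : ℝ) - f x) + ((y' y : ℝ) - g y) := fun x y => by
    rw [ContinuousLinearMap.coprod_apply, EReal.coe_add,
      EReal.add_sub_add_comm (.inl (hf x)) (.inr (hg y))]
  apply le_antisymm
  · exact iSup_le fun p => (hterm p.1 p.2).trans_le
      (add_le_add (apply_sub_le_fenchelConj f x' p.1) (apply_sub_le_fenchelConj g y' p.2))
  · refine EReal.add_le_of_forall_lt fun a ha b hb => ?_
    obtain ⟨x, hx⟩ := lt_iSup_iff.1 ha
    obtain ⟨y, hy⟩ := lt_iSup_iff.1 hb
    calc a + b ≤ ((x' x : ℝ) - f x) + ((y' y : ℝ) - g y) := add_le_add hx.le hy.le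
      _ = (((x'.coprod y') (x, y) : ℝ) : EReal) - (f x + g y) := (hterm x y).symm
      _ ≤ _ := apply_sub_le_fenchelConj (fun p : X × Y => f p.1 + g p.2) _ (x, y)

theorem fitzFun_subdiff_le (f : X → EReal) (p : X × StrongDual ℝ X) :
    fitzFun (subdiff f) p ≤ f p.1 + fenchelConj f p.2 := by
  refine iSup₂_le ?_
  rintro ⟨s, s'⟩ (hs : f s + fenchelConj f s' = ((s' s : ℝ) : EReal))
  have hyoung := apply_sub_le_fenchelConj f s' p.1
  have hyoung' := apply_sub_le_fenchelConj f p.2 s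
  obtain ⟨a, b, ha, hb, hab⟩ := exists_real_of_add_eq_coe hs
  rw [hb] at hyoung
  rw [ha] at hyoung'
  have hfst : ((s' p.1 - b : ℝ) : EReal) ≤ f p.1 := by
    rw [EReal.coe_sub]
    exact EReal.sub_le_of_le_add'
      ((EReal.sub_le_iff_le_add (.inr (EReal.coe_ne_top b)) (.inr (EReal.coe_ne_bot b))).1 hyoung)
  calc ((p.2 s + s' p.1 - s' s : ℝ) : EReal)
      = ((s' p.1 - b : ℝ) : EReal) + ((p.2 s - a : ℝ) : EReal) := by
        rw [← hab, ← EReal.coe_add]; congr 1; ring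
    _ ≤ f p.1 + fenchelConj f p.2 := add_le_add hfst hyoung'

end Conjugate

section SupportFunctional

variable {E : Type*} [NormedAddCommGroup E] [NormedSpace ℝ E] {K : Set (StrongDual ℝ E)}
  {k y' : StrongDual ℝ E}

theorem apply_le_tau (hk : k ∈ K) (x : E) : ((k x : ℝ) : EReal) ≤ tau K x :=
  le_iSup₂ (f := fun (k : StrongDual ℝ E) (_ : k ∈ K) => ((k x : ℝ) : EReal)) k hk

theorem tau_eq_apply_iff_isMaxOn (hk : k ∈ K) {x : E} :
    tau K x = ((k x : ℝ) : EReal) ↔ IsMaxOn (fun k' : StrongDual ℝ E => k' x) K k := by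
  rw [← (apply_le_tau hk x).ge_iff_eq', tau, iSup₂_le_iff, isMaxOn_iff]
  simp only [EReal.coe_le_coe_iff]

theorem exists_isMaxOn_apply (hne : K.Nonempty) (hK : IsCompact (StrongDual.toWeakDual '' K))
    (x : E) : ∃ k ∈ K, IsMaxOn (fun k' : StrongDual ℝ E => k' x) K k := by
  obtain ⟨⟨k, hk, hkx⟩, -⟩ := tau_isGreatest K hne hK x
  exact ⟨k, hk, (tau_eq_apply_iff_isMaxOn hk).1 hkx.symm⟩

theorem exists_tau_lt_apply_of_notMem (hconv : Convex ℝ K)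
    (hclosed : IsClosed (StrongDual.toWeakDual '' K)) (hy : y' ∉ K) :
    ∃ x : E, tau K x < ((y' x : ℝ) : EReal) := by
  have : LocallyConvexSpace ℝ (WeakDual ℝ E) :=
    inferInstanceAs (LocallyConvexSpace ℝ (WeakBilin (topDualPairing ℝ E)))
  obtain ⟨f, u, hfK, hfy⟩ := geometric_hahn_banach_closed_point
    (hconv.linear_image (StrongDual.toWeakDual (𝕜 := ℝ) (E := E)).toLinearMap) hclosed
    (StrongDual.toWeakDual.injective.mem_set_image.not.2 hy)
  obtain ⟨x, rfl⟩ := LinearMap.dualEmbedding_surjective (topDualPairing ℝ E) f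
  refine ⟨x, lt_of_le_of_lt (iSup₂_le fun k hk => ?_) (EReal.coe_lt_coe_iff.2 hfy)⟩
  exact EReal.coe_le_coe_iff.2 (hfK _ ⟨k, hk, rfl⟩).le

theorem fenchelConj_tau_of_mem (hk : k ∈ K) : fenchelConj (tau K) k = 0 := by
  apply le_antisymm
  · exact iSup_le fun x => EReal.sub_nonpos.2 (apply_le_tau hk x)
  · have htau : tau K 0 = ((k 0 : ℝ) : EReal) :=
      (tau_eq_apply_iff_isMaxOn hk).2 fun k' _ => by simp
    simpa [htau] using apply_sub_le_fenchelConj (tau K) k 0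

theorem fenchelConj_tau_of_notMem (hconv : Convex ℝ K)
    (hclosed : IsClosed (StrongDual.toWeakDual '' K)) (hy : y' ∉ K) :
    fenchelConj (tau K) y' = ⊤ := by
  obtain ⟨x, hx⟩ := exists_tau_lt_apply_of_notMem hconv hclosed hy
  obtain ⟨u, hxu, huy⟩ := EReal.lt_iff_exists_real_btwn.1 hx
  refine eq_top_of_forall_mul_add_le (b := 0) (sub_pos.2 (EReal.coe_lt_coe_iff.1 huy))
    fun t ht => ?_
  have htau : tau K (t • x) ≤ ((t * u : ℝ) : EReal) := iSup₂_le fun k hk => by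
    have hku : k x ≤ u := EReal.coe_le_coe_iff.1 ((apply_le_tau hk x).trans hxu.le)
    rw [map_smul, smul_eq_mul, EReal.coe_le_coe_iff]
    gcongr
  calc ((t * (y' x - u) + 0 : ℝ) : EReal)
      = ((y' (t • x) : ℝ) : EReal) - ((t * u : ℝ) : EReal) := by
        rw [← EReal.coe_sub, map_smul, smul_eq_mul]; congr 1; ring
    _ ≤ ((y' (t • x) : ℝ) : EReal) - tau K (t • x) := EReal.sub_le_sub le_rfl htau
    _ ≤ fenchelConj (tau K) y' := apply_sub_le_fenchelConj _ _ _

theorem fenchelConj_fenchelConj_tau (hconv : Convex ℝ K)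
    (hclosed : IsClosed (StrongDual.toWeakDual '' K)) (y'' : StrongDual ℝ (StrongDual ℝ E)) :
    fenchelConj (fenchelConj (tau K)) y'' = ⨆ k ∈ K, ((y'' k : ℝ) : EReal) := by
  refine iSup_congr fun k => ?_
  by_cases hk : k ∈ K
  · simp [fenchelConj_tau_of_mem hk, hk]
  · simp [fenchelConj_tau_of_notMem hconv hclosed hk, hk]

theorem mem_subdiff_tau_iff (hconv : Convex ℝ K)
    (hclosed : IsClosed (StrongDual.toWeakDual '' K)) {x : E} :
    k ∈ subdiff (tau K) x ↔ k ∈ K ∧ IsMaxOn (fun k' : StrongDual ℝ E => k' x) K k := by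
  rw [subdiff, Set.mem_ofPred_eq]
  by_cases hk : k ∈ K
  · simp only [fenchelConj_tau_of_mem hk, add_zero, tau_eq_apply_iff_isMaxOn hk, hk, true_and]
  · rw [fenchelConj_tau_of_notMem hconv hclosed hk]
    induction tau K x <;> simp [hk]

theorem fitzFun_subdiff_tau_of_notMem (hconv : Convex ℝ K)
    (hclosed : IsClosed (StrongDual.toWeakDual '' K))
    (hmax : ∀ x : E, ∃ k ∈ K, IsMaxOn (fun k' : StrongDual ℝ E => k' x) K k)
    (x : E) (hy : y' ∉ K) : fitzFun (subdiff (tau K)) (x, y') = ⊤ := by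
  obtain ⟨s, hs⟩ := exists_tau_lt_apply_of_notMem hconv hclosed hy
  obtain ⟨k, hk, hks⟩ := hmax s
  rw [(tau_eq_apply_iff_isMaxOn hk).2 hks, EReal.coe_lt_coe_iff] at hs
  refine eq_top_of_forall_mul_add_le (b := k x) (sub_pos.2 hs) fun t ht => ?_
  have hkts : IsMaxOn (fun k' : StrongDual ℝ E => k' (t • s)) K k := fun k' hk' => by
    simpa [ht] using hks hk'
  refine le_iSup₂_of_le (t • s, k) ((mem_subdiff_tau_iff hconv hclosed).2 ⟨hk, hkts⟩) ?_
  rw [EReal.coe_le_coe_iff, map_smul, map_smul, smul_eq_mul, smul_eq_mul]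
  linarith

theorem fitzFun_subdiff_tau (hconv : Convex ℝ K)
    (hclosed : IsClosed (StrongDual.toWeakDual '' K))
    (hmax : ∀ x : E, ∃ k ∈ K, IsMaxOn (fun k' : StrongDual ℝ E => k' x) K k)
    (p : E × StrongDual ℝ E) :
    fitzFun (subdiff (tau K)) p = tau K p.1 + fenchelConj (tau K) p.2 := by
  refine le_antisymm (fitzFun_subdiff_le (tau K) p) ?_
  by_cases hp : p.2 ∈ K
  · rw [fenchelConj_tau_of_mem hp, add_zero]
    refine iSup₂_le fun k hk => ?_
    have hk0 : k ∈ subdiff (tau K) 0 :=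
      (mem_subdiff_tau_iff hconv hclosed).2 ⟨hk, fun k' _ => by simp⟩
    exact le_iSup₂_of_le (0, k) hk0 (by simp)
  · exact le_top.trans_eq (fitzFun_subdiff_tau_of_notMem hconv hclosed hmax p.1 hp).symm

theorem fenchelConj_fitzFun_subdiff_tau (hconv : Convex ℝ K)
    (hclosed : IsClosed (StrongDual.toWeakDual '' K))
    (hmax : ∀ x : E, ∃ k ∈ K, IsMaxOn (fun k' : StrongDual ℝ E => k' x) K k)
    (y' : StrongDual ℝ E) (y'' : StrongDual ℝ (StrongDual ℝ E)) :
    fenchelConj (fitzFun (subdiff (tau K))) (y'.coprod y'') =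
      fenchelConj (tau K) y' + ⨆ k ∈ K, ((y'' k : ℝ) : EReal) := by
  have htau : ∀ x, tau K x ≠ ⊥ := fun x => by
    obtain ⟨k, hk, -⟩ := hmax x
    exact ne_bot_of_le_ne_bot (EReal.coe_ne_bot _) (apply_le_tau hk x)
  have hconj : ∀ x', fenchelConj (tau K) x' ≠ ⊥ := fun x' => by
    by_cases hx' : x' ∈ K
    · simp [fenchelConj_tau_of_mem hx']
    · simp [fenchelConj_tau_of_notMem hconv hclosed hx']
  rw [funext (fitzFun_subdiff_tau hconv hclosed hmax), fenchelConj_add_coprod htau hconj,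
    fenchelConj_fenchelConj_tau hconv hclosed]

end SupportFunctional

end FitzExt

theorem mainTheorem10_general {E : Type*} [NormedAddCommGroup E] [NormedSpace ℝ E]
    {K : Set (StrongDual ℝ E)} (hconv : Convex ℝ K)
    (hclosed : IsClosed (StrongDual.toWeakDual '' K))
    (hmax : ∀ x : E, ∃ k ∈ K, IsMaxOn (fun k' : StrongDual ℝ E => k' x) K k)
    (y' : StrongDual ℝ E) (y'' : StrongDual ℝ (StrongDual ℝ E)) :
    (y', y'') ∈ FitzExt.graph (FitzExt.fitzExt (FitzExt.subdiff (FitzExt.tau K))) ↔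
      y' ∈ K ∧ ((y'' y' : ℝ) : EReal) = ⨆ k ∈ K, ((y'' k : ℝ) : EReal) := by
  simp only [FitzExt.graph, FitzExt.fitzExt, Set.mem_ofPred_eq,
    FitzExt.fenchelConj_fitzFun_subdiff_tau hconv hclosed hmax]
  by_cases hy : y' ∈ K
  · simp only [FitzExt.fenchelConj_tau_of_mem hy, zero_add, hy, true_and, eq_comm]
  · rw [FitzExt.fenchelConj_tau_of_notMem hconv hclosed hy]
    induction ⨆ k ∈ K, ((y'' k : ℝ) : EReal) <;> simp [hy]

theorem mainTheorem10 {E : Type*} [NormedAddCommGroup E] [NormedSpace ℝ E] [CompleteSpace E]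
    (K : Set (StrongDual ℝ E)) (hne : K.Nonempty) (hconv : Convex ℝ K)
    (hK : IsCompact (StrongDual.toWeakDual '' K))
    (y' : StrongDual ℝ E) (y'' : StrongDual ℝ (StrongDual ℝ E)) :
    (y', y'') ∈ FitzExt.graph (FitzExt.fitzExt (FitzExt.subdiff (FitzExt.tau K))) ↔
      y' ∈ K ∧ ((y'' y' : ℝ) : EReal) = ⨆ k ∈ K, ((y'' k : ℝ) : EReal) :=
  mainTheorem10_general hconv hK.isClosed (FitzExt.exists_isMaxOn_apply hne hK) y' y''
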